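/- Let $R$ be a Noetherian local ring with maximal ideal $m_R$, and let $\mathcal I=\{I_n\}_{n\ge 0}$ be an arbitrary filtration of ideals of $R$, that is, a descending chain $R=I_0\supseteq I_1\supseteq I_2\supseteq\cdots$ of ideals with $I_iI_j\subseteq I_{i+j}$ for all $i,j\ge 0$. Its Rees algebra $R[\mathcal I]=\sum_{n\ge 0}I_nt^n\subseteq R[t]$ is not assumed to be Noetherian. Assume that $I_1\neq R$ or $\dim R>0$. Then the analytic spread $\ell(\mathcal I):=\dim R[\mathcal I]/m_RR[\mathcal I]$ (Krull dimension) satisfies $$\ell(\mathcal I)\le \dim R.$$ -/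

import Mathlib

/-- A filtration of ideals on a commutative ring `R`: a descending chain
`R = I₀ ⊇ I₁ ⊇ I₂ ⊇ ⋯` of ideals such that `Iᵢ Iⱼ ⊆ Iᵢ₊ⱼ` for all `i, j`. -/
structure IdealFiltration (R : Type*) [CommRing R] where
  /-- The `n`-th ideal of the filtration. -/
  ideal : ℕ → Ideal R
  ideal_zero : ideal 0 = ⊤
  antitone : Antitone ideal
  mul_le : ∀ i j, ideal i * ideal j ≤ ideal (i + j)

namespace IdealFiltration

/-- The Rees algebra `R[𝓘] = ∑ₙ Iₙ tⁿ` of a filtration, as the `R`-subalgebra of `R[t]` of all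
polynomials whose coefficient of `tⁿ` lies in `Iₙ` for every `n`. -/
noncomputable def reesAlgebra {R : Type*} [CommRing R] (F : IdealFiltration R) :
    Subalgebra R (Polynomial R) where
  carrier := { f | ∀ n, f.coeff n ∈ F.ideal n }
  mul_mem' hf hg n := by
    rw [Polynomial.coeff_mul]
    apply Ideal.sum_mem
    rintro ⟨j, k⟩ e
    rw [← Finset.HasAntidiagonal.mem_antidiagonal.mp e]
    exact F.mul_le j k (Ideal.mul_mem_mul (hf j) (hg k))
  add_mem' hf hg n := by
    rw [Polynomial.coeff_add]
    exact Ideal.add_mem _ (hf n) (hg n)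
  algebraMap_mem' r n := by
    rw [Polynomial.algebraMap_apply, Polynomial.coeff_C]
    split_ifs with h
    · subst h
      simp [F.ideal_zero]
    · simp

/-- The extension `m_R R[𝓘]` of the maximal ideal of a local ring `R` to the Rees algebra. -/
noncomputable def extendedMaximalIdeal {R : Type*} [CommRing R] [IsLocalRing R] (F : IdealFiltration R) :
    Ideal F.reesAlgebra :=
  (IsLocalRing.maximalIdeal R).map (algebraMap R F.reesAlgebra)

/-- The analytic spread `ℓ(𝓘) = dim R[𝓘] / m_R R[𝓘]` (Krull dimension) of a filtration `𝓘` of a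
local ring. -/
noncomputable def analyticSpread {R : Type*} [CommRing R] [IsLocalRing R]
    (F : IdealFiltration R) : WithBot ℕ∞ :=
  ringKrullDim (F.reesAlgebra ⧸ F.extendedMaximalIdeal)

end IdealFiltration

/-! Every prime of `R[𝓘]` contains the kernel `q` of reduction modulo some minimal prime `p` of `R`,
and `R[𝓘]/q` is a domain between `R/p` and `(R/p)[X]`. Its transcendence degree over `R/p` is at
most 1, so its dimension is at most `dim R + 1`, even if it is not Noetherian. A chain of primes
over `m_R R[𝓘]` that starts strictly above `q` can be extended down by `q`, which saves the 1. If it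
starts at `q`, then `m_R ⊆ p`, so `dim R = 0`; the hypothesis gives `I₁ ⊆ p`, and `R[𝓘]/q` is a
quotient of `R`. -/

/-- The Krull dimension of an algebra is at most the supremum of the Krull dimensions of its
finitely generated subalgebras. -/
theorem ringKrullDim_le_of_forall_adjoin_finset {A B : Type*} [CommRing A] [CommRing B]
    [Algebra A B] {N : WithBot ℕ∞}
    (h : ∀ s : Finset B, ringKrullDim (Algebra.adjoin A (s : Set B)) ≤ N) :
    ringKrullDim B ≤ N := by
  classical
  refine iSup_le fun l ↦ ?_
  have hex (i : Fin l.length) :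
      ∃ x, x ∈ (l i.succ).asIdeal ∧ x ∉ (l i.castSucc).asIdeal :=
    Set.exists_of_ssubset (l.step i)
  choose x hx hx' using hex
  -- One witness per strict inclusion keeps the chain strict after contraction to the subalgebra
  -- they generate.
  let s : Finset B := Finset.univ.image x
  have hs (i) : x i ∈ Algebra.adjoin A (s : Set B) :=
    Algebra.subset_adjoin (by simp [s])
  let f := algebraMap (Algebra.adjoin A (s : Set B)) B
  let l' : LTSeries (PrimeSpectrum (Algebra.adjoin A (s : Set B))) :=
    { length := l.length
      toFun := fun i ↦ PrimeSpectrum.comap f (l i)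
      step := fun i ↦ by
        refine lt_of_le_of_ne (Ideal.comap_mono (l.step i).le) fun e ↦ hx' i ?_
        have h1 : (⟨x i, hs i⟩ : Algebra.adjoin A (s : Set B)) ∈
            (PrimeSpectrum.comap f (l i.succ)).asIdeal := hx i
        have h2 : PrimeSpectrum.comap f (l i.castSucc) = PrimeSpectrum.comap f (l i.succ) :=
          PrimeSpectrum.ext e
        rw [← h2] at h1
        exact h1 }
  exact (Order.LTSeries.length_le_krullDim l').trans (h s)

/-- Adjoining an algebraic element to a Noetherian domain does not raise the Krull dimension. -/
theorem ringKrullDim_range_aeval_le {A B : Type*} [CommRing A] [IsDomain A]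
    [IsNoetherianRing A] [CommRing B] [Algebra A B] {x : B} (hx : IsAlgebraic A x) :
    ringKrullDim (Polynomial.aeval (R := A) x).range ≤ ringKrullDim A := by
  obtain ⟨p, hp, hpx⟩ := hx
  -- `A[X]` has dimension `dim A + 1`, and passing to a quotient that kills the nonzerodivisor `p`
  -- lowers it by at least 1.
  apply ENat.WithBot.add_le_add_one_right_iff.mp
  rw [← Polynomial.ringKrullDim_of_isNoetherianRing (R := A)]
  exact ringKrullDim_succ_le_of_surjective (Polynomial.aeval x).rangeRestrict.toRingHom
    (Polynomial.aeval x).rangeRestrict_surjective (mem_nonZeroDivisors_of_ne_zero hp)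
    (Subtype.ext hpx)

/-- An algebraic domain extension of a Noetherian domain has at most the same Krull dimension. -/
theorem ringKrullDim_le_of_isAlgebraic (A B : Type*) [CommRing A] [IsDomain A]
    [IsNoetherianRing A] [CommRing B] [IsDomain B] [Algebra A B] [FaithfulSMul A B]
    [Algebra.IsAlgebraic A B] : ringKrullDim B ≤ ringKrullDim A := by
  classical
  refine ringKrullDim_le_of_forall_adjoin_finset (A := A) fun s ↦ ?_
  induction s using Finset.induction_on with
  | empty =>
    refine ringKrullDim_le_of_surjective (algebraMap A (Algebra.adjoin A ((∅ : Finset B) : Set B)))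
      ?_
    rintro ⟨y, hy⟩
    rw [Finset.coe_empty, Algebra.adjoin_empty, Algebra.mem_bot] at hy
    obtain ⟨a, rfl⟩ := hy
    exact ⟨a, rfl⟩
  | insert x s _ ih =>
    let C := Algebra.adjoin A (s : Set B)
    have : Algebra.FiniteType A C := .adjoin_of_finite s.finite_toSet
    have : IsNoetherianRing C := Algebra.FiniteType.isNoetherianRing A C
    have hx : IsAlgebraic C x := (Algebra.IsAlgebraic.isAlgebraic (R := A) x).extendScalars
      (FaithfulSMul.algebraMap_injective A C)
    have e : Algebra.adjoin A ((insert x s : Finset B) : Set B) =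
        (Polynomial.aeval (R := C) x).range.restrictScalars A := by
      rw [← Algebra.adjoin_singleton_eq_range_aeval, ← Algebra.adjoin_union_eq_adjoin_adjoin, Finset.coe_insert, Set.insert_eq, Set.union_comm]
    rw [e]
    exact (ringKrullDim_range_aeval_le hx).trans ih

/-- The dimension inequality for a domain of transcendence degree at most `n` over a Noetherian
subdomain. -/
theorem ringKrullDim_le_add_of_trdeg_le (R B : Type*) [CommRing R] [IsDomain R]
    [IsNoetherianRing R] [CommRing B] [IsDomain B] [Algebra R B] [FaithfulSMul R B] {n : ℕ}
    (h : Algebra.trdeg R B ≤ n) : ringKrullDim B ≤ ringKrullDim R + n := by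
  obtain ⟨s, hs⟩ := exists_isTranscendenceBasis R B
  have hc : Cardinal.mk s ≤ n := hs.1.cardinalMk_le_trdeg.trans h
  have : Finite s := Cardinal.lt_aleph0_iff_finite.mp (hc.trans_lt (Cardinal.natCast_lt_aleph0))
  have hcard : Nat.card s ≤ n := by
    simpa [Nat.card] using Cardinal.toNat_le_toNat hc Cardinal.natCast_lt_aleph0
  let C := Algebra.adjoin R (Set.range ((↑) : s → B))
  have : Algebra.IsAlgebraic C B := hs.isAlgebraic
  have hC : C = (MvPolynomial.aeval ((↑) : s → B)).range := Algebra.adjoin_range_eq_range_aeval R _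
  have : Algebra.FiniteType R C :=
    .adjoin_of_finite (Set.finite_range _)
  have : IsNoetherianRing C := Algebra.FiniteType.isNoetherianRing R C
  calc ringKrullDim B ≤ ringKrullDim C := ringKrullDim_le_of_isAlgebraic C B
    _ ≤ ringKrullDim (MvPolynomial s R) := by
      rw [hC]
      exact ringKrullDim_le_of_surjective
        (MvPolynomial.aeval ((↑) : s → B)).rangeRestrict.toRingHom
        (MvPolynomial.aeval ((↑) : s → B)).rangeRestrict_surjective
    _ = ringKrullDim R + Nat.card s := MvPolynomial.ringKrullDim_of_isNoetherianRing
    _ ≤ ringKrullDim R + n := by gcongr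

namespace IdealFiltration

open Polynomial

variable {R : Type*} [CommRing R] (F : IdealFiltration R)

/-- Reduction of the coefficients of the Rees algebra modulo an ideal of the base ring. -/
noncomputable def reesReduction (p : Ideal R) : F.reesAlgebra →+* (R ⧸ p)[X] :=
  (mapRingHom (Ideal.Quotient.mk p)).comp (F.reesAlgebra.val : F.reesAlgebra →+* R[X])

theorem mem_ker_reesReduction {p : Ideal R} {f : F.reesAlgebra} :
    f ∈ RingHom.ker (F.reesReduction p) ↔ ∀ n, (f : R[X]).coeff n ∈ p := by
  simp [reesReduction, RingHom.mem_ker, Polynomial.ext_iff, Ideal.Quotient.eq_zero_iff_mem]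

/-- The image of the Rees algebra in `(R ⧸ p)[X]`, as an algebra over `R ⧸ p`. -/
noncomputable def reesImage (p : Ideal R) : Subalgebra (R ⧸ p) (R ⧸ p)[X] where
  __ := (F.reesReduction p).range
  algebraMap_mem' r := by
    obtain ⟨r, rfl⟩ := Ideal.Quotient.mk_surjective r
    exact ⟨algebraMap R F.reesAlgebra r, by simp [reesReduction]⟩

theorem ringKrullDim_quotient_ker_reesReduction_le [IsNoetherianRing R] (p : Ideal R)
    [p.IsPrime] :
    ringKrullDim (F.reesAlgebra ⧸ RingHom.ker (F.reesReduction p)) ≤ ringKrullDim R + 1 := by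
  have ht : Algebra.trdeg (R ⧸ p) (F.reesImage p) ≤ (1 : ℕ) := by
    simpa [Polynomial.trdeg_of_isDomain] using
      trdeg_le_of_injective (F.reesImage p).val Subtype.val_injective
  calc ringKrullDim (F.reesAlgebra ⧸ RingHom.ker (F.reesReduction p))
      = ringKrullDim (F.reesImage p) :=
        ringKrullDim_eq_of_ringEquiv (RingHom.quotientKerEquivRange (F.reesReduction p))
    _ ≤ ringKrullDim (R ⧸ p) + 1 := by
      simpa using ringKrullDim_le_add_of_trdeg_le (R ⧸ p) (F.reesImage p) ht
    _ ≤ ringKrullDim R + 1 := by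
      gcongr
      exact ringKrullDim_quotient_le p

/-- The finitely many kernels meet in nilpotent elements, so their intersection lies in `P`, and
primality selects one of them. -/
theorem exists_minimalPrime_ker_reesReduction_le [IsNoetherianRing R] (P : Ideal F.reesAlgebra)
    [P.IsPrime] : ∃ p ∈ minimalPrimes R, RingHom.ker (F.reesReduction p) ≤ P := by
  have hfin : (minimalPrimes R).Finite := minimalPrimes.finite_of_isNoetherianRing R
  have key : hfin.toFinset.inf (fun p ↦ RingHom.ker (F.reesReduction p)) ≤ P := by
    intro f hf
    simp only [Submodule.mem_finsetInf, Set.Finite.mem_toFinset, mem_ker_reesReduction] at hf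
    have hnil : IsNilpotent (f : R[X]) := by
      refine Polynomial.isNilpotent_iff.mpr fun n ↦ ?_
      rw [← mem_nilradical, nilradical, ← Ideal.sInf_minimalPrimes, Submodule.mem_sInf]
      exact fun p hp ↦ hf p hp n
    obtain ⟨k, hk⟩ := hnil
    refine Ideal.IsPrime.mem_of_pow_mem ‹_› k ?_
    have : f ^ k = 0 := Subtype.ext (by simpa using hk)
    simp [this]
  obtain ⟨p, hp, h⟩ := (Ideal.IsPrime.inf_le' ‹_›).mp key
  exact ⟨p, by simpa using hp, h⟩

/-- If all ideals of positive index are contained in `p`, then the Rees algebra reduced modulo `p`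
is a quotient of the base ring. -/
theorem ringKrullDim_quotient_ker_reesReduction_le_of_ideal_one_le {p : Ideal R}
    (h : F.ideal 1 ≤ p) :
    ringKrullDim (F.reesAlgebra ⧸ RingHom.ker (F.reesReduction p)) ≤ ringKrullDim R := by
  refine ringKrullDim_le_of_surjective
    ((Ideal.Quotient.mk _).comp (algebraMap R F.reesAlgebra)) fun y ↦ ?_
  obtain ⟨f, rfl⟩ := Ideal.Quotient.mk_surjective y
  refine ⟨(f : R[X]).coeff 0, Ideal.Quotient.eq.mpr (F.mem_ker_reesReduction.mpr fun n ↦ ?_)⟩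
  rcases n with _ | n
  · simp
  · have := h (F.antitone (Nat.le_add_left 1 n) (f.2 (n + 1)))
    simpa [Polynomial.coeff_C] using this

end IdealFiltration

theorem mainTheorem11 {R : Type*} [CommRing R] [IsLocalRing R] [IsNoetherianRing R]
    (F : IdealFiltration R) (hF : F.ideal 1 ≠ ⊤ ∨ 0 < ringKrullDim R) :
    F.analyticSpread ≤ ringKrullDim R := by
  rw [IdealFiltration.analyticSpread, ringKrullDim_quotient]
  refine iSup_le fun l ↦ ?_
  obtain ⟨p, hp, hle⟩ := F.exists_minimalPrime_ker_reesReduction_le l.head.1.asIdeal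
  have : p.IsPrime := hp.1.1
  have hker : (RingHom.ker (F.reesReduction p)).IsPrime := RingHom.ker_isPrime _
  let q : PrimeSpectrum F.reesAlgebra := ⟨RingHom.ker (F.reesReduction p), hker⟩
  let l₀ : LTSeries (PrimeSpectrum F.reesAlgebra) := l.map Subtype.val (fun _ _ ↦ id)
  have bound (l₁ : LTSeries (PrimeSpectrum F.reesAlgebra)) (h : q ≤ l₁.head) :
      (l₁.length : WithBot ℕ∞) ≤
        ringKrullDim (F.reesAlgebra ⧸ RingHom.ker (F.reesReduction p)) := by
    rw [ringKrullDim_quotient]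
    let l₂ : LTSeries (PrimeSpectrum.zeroLocus
        (RingHom.ker (F.reesReduction p) : Set F.reesAlgebra)) :=
      { length := l₁.length
        toFun := fun i ↦ ⟨l₁ i, h.trans (l₁.head_le i)⟩
        step := fun i ↦ l₁.step i }
    exact Order.LTSeries.length_le_krullDim l₂
  obtain hlt | heq := lt_or_eq_of_le (show q ≤ l₀.head from hle)
  · apply ENat.WithBot.add_le_add_one_right_iff.mp
    refine le_trans ?_ (F.ringKrullDim_quotient_ker_reesReduction_le p)
    have h := bound (l₀.cons q hlt) le_rfl
    rw [RelSeries.cons_length] at h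
    exact_mod_cast h
  · have hmp : IsLocalRing.maximalIdeal R ≤ p := fun r hr ↦ by
      have h1 : algebraMap R F.reesAlgebra r ∈ l.head.1.asIdeal :=
        l.head.2 (Ideal.mem_map_of_mem _ hr)
      have h2 : algebraMap R F.reesAlgebra r ∈ q.asIdeal := by rw [heq]; exact h1
      simpa using F.mem_ker_reesReduction.mp h2 0
    -- Every prime lies in `m_R ⊆ p`, and `p` is minimal, so all primes coincide.
    have hdim : ¬ 0 < ringKrullDim R := by
      rw [not_lt, ringKrullDim, Order.krullDim_nonpos_iff_forall_isMin]
      intro x y hyx r hr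
      exact hp.2 ⟨y.2, bot_le⟩ 
        (((show y.asIdeal ≤ x.asIdeal from hyx).trans
          (IsLocalRing.le_maximalIdeal x.2.ne_top)).trans hmp)
        (hmp (IsLocalRing.le_maximalIdeal x.2.ne_top hr))
    have h1 : F.ideal 1 ≤ p :=
      (IsLocalRing.le_maximalIdeal (hF.resolve_right hdim)).trans hmp
    exact (bound l₀ heq.le).trans (F.ringKrullDim_quotient_ker_reesReduction_le_of_ideal_one_le h1)
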